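/- **Definitions.** Write $I_n$ for the identity on $n$ qubits. For $n,m\in\mathbb N$, the *generalized Hilbert–Schmidt ensemble* $\eta_{n,m}$ is the law of the $n$-qubit density matrix $\operatorname{tr}_m(|\psi\rangle\langle\psi|)$, where $|\psi\rangle$ is a Haar random pure state of $n+m$ qubits and $\operatorname{tr}_m$ traces out the last $m$ qubits. A function $f:\mathbb N\to\mathbb N$ is $\mathrm{poly}(n)$ if it is bounded by a polynomial in $n$. A nonnegative function $\mu:\mathbb N\to\mathbb R$ is *negligible*, $\mu(n)=\operatorname{negl}(n)$, if for every $c\in\mathbb N$ there is $n_0$ such that $\mu(n)<n^{-c}$ for all $n>n_0$. An *efficient quantum algorithm* is a uniform family of quantum circuits: a classical polynomial-time Turing machine computes, from the classical input, the description of a circuit over Hadamard, $\mathrm{CNOT}$ and the phase gates $\operatorname{diag}(1,e^{2\pi i/2^j})$, with all numbers in the description (of ancillas, wires and $j$) written in unary. The circuit is run with ancillas in $|0\rangle$. A distinguisher $\mathcal A$ gets the classical input $1^n$ and a quantum input, and outputs the result of a computational-basis measurement of the first wire. A state generator gets a classical input only, and outputs the first $n$ qubits, the others being discarded. Let $m,\kappa:\mathbb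 N\to\mathbb N$. A keyed family of $n$-qubit density matrices $\rho_{k}=\rho_{k,m(n)}$, $k\in\mathcal K=\{0,1\}^{\kappa(n)}$, $n\in\mathbb N$, is a *pseudorandom density matrix (PRDM)* ensemble with mixedness parameter $m=m(n)$ if $\kappa=\mathrm{poly}(n)$ and 1. (efficiently preparable) there is an efficient quantum algorithm $\mathcal G$ which on input $(1^n,1^\kappa,k,m)$ outputs exactly the state $\rho_{k,m}$, for all $n$ and $k$; 2. (computationally indistinguishable from $\eta_{n,m}$) for every $t=\mathrm{poly}(n)$ and every efficient quantum distinguisher $\mathcal A$, $$\Big|\Pr_{k\leftarrow\mathcal K}[\mathcal A(\rho_{k,m}^{\otimes t})=1]-\Pr_{\rho\leftarrow\eta_{n,m}}[\mathcal A(\rho^{\otimes t})=1]\Big|=\operatorname{negl}(n).$$ **Theorem.** Let $\{\rho_k\}$ be a PRDM ensemble with mixedness parameter $m=\omega(\log n)$, and let $\sigma_n=I_n/2^n$ be the maximally mixed state of $n$ qubits. Then for every $t=\mathrm{poly}(n)$ and every efficient quantum distinguisher $\mathcal A$, $$\Big|\Pr_{k\leftarrow\mathcal K}[\mathcal A(\rho_k^{\otimes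 t})=1]-\Pr[\mathcal A(\sigma_n^{\otimes t})=1]\Big|=\operatorname{negl}(n).$$ -/

import Mathlib

open MeasureTheory Filter Asymptotics
open scoped ComplexOrder

noncomputable section

namespace PRDM

/-! ### Qubit registers, states, tensor powers, partial trace -/

/-- Computational basis labels of `N` qubits. -/
abbrev Bits (N : ℕ) : Type := Fin N → Bool

/-- Linear operators on the space of `N` qubits, as matrices in the computational basis. -/
abbrev Op (N : ℕ) : Type := Matrix (Bits N) (Bits N) ℂ

/-- Density matrices: positive semidefinite with unit trace. -/
def IsDensity {N : ℕ} (ρ : Op N) : Prop := ρ.PosSemidef ∧ ρ.trace = 1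

/-- The maximally mixed state `I / 2^n`. -/
def maxMixed (n : ℕ) : Op n := ((2 : ℂ) ^ n)⁻¹ • (1 : Op n)

/-- The projector `|0…0⟩⟨0…0|`. -/
def zeroState (N : ℕ) : Op N :=
  Matrix.single (fun _ : Fin N => false) (fun _ : Fin N => false) (1 : ℂ)

/-- `ρ^{⊗ t}` on `t * n` qubits; qubit `i` of copy `j` is wire `i + n * j`. -/
def tensorPow {n : ℕ} (t : ℕ) (ρ : Op n) : Op (t * n) :=
  Matrix.of fun x y => ∏ j : Fin t,
    ρ (fun i => x (finProdFinEquiv (j, i))) (fun i => y (finProdFinEquiv (j, i)))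

/-- `σ ⊗ ρ` on `a + q` qubits, the first `a` qubits carrying `σ`. -/
def tensor {a q : ℕ} (σ : Op a) (ρ : Op q) : Op (a + q) :=
  Matrix.of fun x y =>
    σ (fun i => x (Fin.castAdd q i)) (fun i => y (Fin.castAdd q i)) *
      ρ (fun i => x (Fin.natAdd a i)) (fun i => y (Fin.natAdd a i))

/-- Partial trace over the last `m` of `n + m` qubits. -/
def traceOut {n m : ℕ} (M : Op (n + m)) : Op n :=
  Matrix.of fun x y => ∑ z : Bits m, M (Fin.append x z) (Fin.append y z)

/-! ### Haar random states and the generalized Hilbert–Schmidt ensemble -/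

/-- State vectors of `N` qubits. -/
abbrev Ket (N : ℕ) : Type := EuclideanSpace ℂ (Bits N)

/-- Pure states of `N` qubits: unit vectors. -/
abbrev PureState (N : ℕ) : Type := Metric.sphere (0 : Ket N) 1

/-- The projector `|ψ⟩⟨ψ|`. -/
def projector {N : ℕ} (ψ : PureState N) : Op N :=
  Matrix.of fun x y => (ψ : Ket N) x * star ((ψ : Ket N) y)

/-- The Haar measure on pure states, i.e. the uniform (unitarily invariant) probability measure on
the unit sphere: normalized surface measure. -/
def haar (N : ℕ) : Measure (PureState N) :=
  ((volume : Measure (Ket N)).toSphere Set.univ)⁻¹ • (volume : Measure (Ket N)).toSphere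

instance haar_isProbabilityMeasure (N : ℕ) : IsProbabilityMeasure (haar N) := by
  constructor
  have h0 : (volume : Measure (Ket N)).toSphere Set.univ ≠ 0 := by
    rw [Measure.measure_univ_ne_zero]
    exact Measure.toSphere_ne_zero _
  rw [haar, Measure.smul_apply, smul_eq_mul]
  exact ENNReal.inv_mul_cancel h0 (measure_ne_top _ _)

/-- Operators carry the product (equivalently, Borel) σ-algebra of their matrix entries. -/
instance opMeasurableSpace (N : ℕ) : MeasurableSpace (Op N) :=
  inferInstanceAs (MeasurableSpace (Bits N → Bits N → ℂ))

/-- The `(n, m)` generalized Hilbert–Schmidt ensemble: the law of `tr_m |ψ⟩⟨ψ|` for a Haar random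
pure state `ψ` of `n + m` qubits. -/
def ghse (n m : ℕ) : Measure (Op n) :=
  (haar (n + m)).map fun ψ => traceOut (projector ψ)

/-- The map in the definition of `ghse` is measurable. -/
theorem measurable_traceOut_projector (n m : ℕ) :
    Measurable fun ψ : PureState (n + m) => traceOut (projector ψ) := by
  refine measurable_pi_lambda _ fun x => measurable_pi_lambda _ fun y => ?_
  refine Finset.measurable_sum _ fun z _ => ?_
  have h : ∀ b : Bits (n + m), Measurable fun ψ : PureState (n + m) => (ψ : Ket (n + m)) b := by
    intro b
    have : Continuous fun ψ : PureState (n + m) => (ψ : Ket (n + m)) b := by fun_prop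
    exact this.measurable
  exact (h _).mul (continuous_star.measurable.comp (h _))

instance ghse_isProbabilityMeasure (n m : ℕ) : IsProbabilityMeasure (ghse n m) :=
  Measure.isProbabilityMeasure_map (measurable_traceOut_projector n m).aemeasurable

/-! ### Quantum circuits and efficient quantum algorithms -/

/-- Gates: Hadamard on wire `w`; the phase gate `diag(1, exp(2πi / 2^j))` on wire `w` (`j = 1, 2, 3`
are `Z`, `S`, `T`, so the gates include the universal set `H`, `T`, `CNOT`); `CNOT`. -/
inductive Gate : Type
  | hadamard (w : ℕ)
  | phase (j w : ℕ)
  | cnot (control target : ℕ)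

/-- A circuit description: the number of ancilla qubits and the gates in order of application.
Intermediate measurements are deferred to the end. -/
structure Circuit where
  anc : ℕ
  gates : List Gate

/-- The operator of a gate on `N` wires. A gate naming a wire that does not exist, or a `CNOT` whose
control and target coincide, acts as the identity. -/
def Gate.op (N : ℕ) : Gate → Op N
  | .hadamard w =>
      if h : w < N then
        Matrix.of fun x y =>
          if ∀ i : Fin N, i ≠ ⟨w, h⟩ → x i = y i then
            (if x ⟨w, h⟩ = true ∧ y ⟨w, h⟩ = true then -1 else 1) / ((Real.sqrt 2 : ℝ) : ℂ)
          else 0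
      else 1
  | .phase j w =>
      if h : w < N then
        Matrix.diagonal fun x =>
          if x ⟨w, h⟩ = true then Complex.exp (2 * (Real.pi : ℂ) * Complex.I / 2 ^ j) else 1
      else 1
  | .cnot c d =>
      if h : c < N ∧ d < N ∧ c ≠ d then
        Matrix.of fun x y =>
          if x = Function.update y ⟨d, h.2.1⟩ (xor (y ⟨d, h.2.1⟩) (y ⟨c, h.1⟩)) then 1 else 0
      else 1

/-- The operator of a list of gates; the head of the list acts first. -/
def gatesOp (N : ℕ) : List Gate → Op N
  | [] => 1
  | g :: gs => gatesOp N gs * g.op N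

/-- The state after running the gates on `ρ`. -/
def runGates {N : ℕ} (gs : List Gate) (ρ : Op N) : Op N :=
  gatesOp N gs * ρ * (gatesOp N gs).conjTranspose

/-- Preparing an `n`-qubit state: run the circuit on `|0…0⟩` with `n` output wires followed by
`C.anc` ancilla wires, then discard the ancillas. -/
def Circuit.output (C : Circuit) (n : ℕ) : Op n :=
  traceOut (runGates C.gates (zeroState (n + C.anc)))

/-- `Pr[C(ρ) = 1]`: run the circuit on `C.anc` wires in state `|0⟩` followed by the input wires in
state `ρ`, and measure wire `0` in the computational basis. -/
def Circuit.acceptProb (C : Circuit) {q : ℕ} (ρ : Op q) : ℝ :=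
  ∑ x : Bits (C.anc + q),
    if ∃ h : 0 < C.anc + q, x ⟨0, h⟩ = true then
      (runGates C.gates (tensor (zeroState C.anc) ρ) x x).re
    else 0

/-- Alphabet of circuit descriptions. -/
inductive Sym : Type
  | hadamard | phase | cnot | tick | comma

/-- Unary numerals. -/
def tally (k : ℕ) : List Sym := List.replicate k Sym.tick

/-- Description of a gate, all numbers in unary. -/
def Gate.encode : Gate → List Sym
  | .hadamard w => Sym.hadamard :: tally w
  | .phase j w => Sym.phase :: (tally j ++ Sym.comma :: tally w)
  | .cnot c d => Sym.cnot :: (tally c ++ Sym.comma :: tally d)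

/-- Description of a circuit: the number of ancillas in unary, then the gates. -/
def Circuit.encode (C : Circuit) : List Sym := tally C.anc ++ C.gates.flatMap Gate.encode

/-- An efficient quantum distinguisher: a uniform family of polynomial-size quantum circuits, the
description of the `n`-th circuit being computed by a Turing machine from `1^n` in polynomial
time. -/
def EfficientAdversary (A : ℕ → Circuit) : Prop :=
  Nonempty (Turing.TM2ComputableInPolyTime Computability.unaryEncodingNat.encode Circuit.encode A)

/-- Inputs `(n, k, m)` of a state generator: `n` in unary, the key `k` as a bit string (its length
is the key length, which is thereby given in unary), and `m` in binary. -/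
def genInputEncoding : Computability.Encoding (ℕ × List Bool × ℕ) (Bool ⊕ Bool ⊕ Bool) :=
  Computability.encodingProd Computability.unaryEncodingNat
    (Computability.encodingProd (Computability.encodingList Bool) Computability.encodingNatBool)

/-- An efficient quantum state generator: a polynomial-time Turing machine computes from `(n, k, m)`
the description of the circuit to be run. -/
def EfficientGenerator (G : ℕ × List Bool × ℕ → Circuit) : Prop :=
  Nonempty (Turing.TM2ComputableInPolyTime genInputEncoding.encode Circuit.encode G)

/-! ### Asymptotics and pseudorandom density matrices -/

/-- `f = poly(n)`: bounded by a polynomial. -/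
def PolyBounded (f : ℕ → ℕ) : Prop := ∃ p : Polynomial ℕ, ∀ n, f n ≤ p.eval n

/-- A nonnegative function is negligible if it decays faster than every inverse polynomial. -/
def Negligible (f : ℕ → ℝ) : Prop :=
  ∀ c : ℕ, ∃ n₀ : ℕ, ∀ n : ℕ, n₀ < n → f n < ((n : ℝ) ^ c)⁻¹

/-- `Pr_{k ← {0,1}^κ}[C(ρ_k^{⊗ t}) = 1]` for a uniformly random key `k`. -/
def keyAcceptProb (C : Circuit) {κ n : ℕ} (t : ℕ) (ρ : Bits κ → Op n) : ℝ :=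
  (∑ k : Bits κ, C.acceptProb (tensorPow t (ρ k))) / 2 ^ κ

/-- `Pr_{ρ ← η_{n,m}}[C(ρ^{⊗ t}) = 1]` for `ρ` drawn from the generalized Hilbert–Schmidt
ensemble. -/
def ghseAcceptProb (C : Circuit) (t n m : ℕ) : ℝ :=
  ∫ ρ, C.acceptProb (tensorPow t ρ) ∂(ghse n m)

/-- The keyed family `ρ n k`, `k ∈ {0,1}^(κ n)`, of `n`-qubit density matrices is a pseudorandom
density matrix (PRDM) ensemble with mixedness parameter `m = m n`. -/
structure IsPRDM (κ m : ℕ → ℕ) (ρ : (n : ℕ) → Bits (κ n) → Op n) : Prop where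
  keyLength_poly : PolyBounded κ
  isDensity : ∀ n k, IsDensity (ρ n k)
  efficiently_preparable : ∃ G : ℕ × List Bool × ℕ → Circuit, EfficientGenerator G ∧
    ∀ n k, (G (n, List.ofFn k, m n)).output n = ρ n k
  indistinguishable : ∀ t : ℕ → ℕ, PolyBounded t → ∀ A : ℕ → Circuit, EfficientAdversary A →
    Negligible fun n => |keyAcceptProb (A n) (t n) (ρ n) - ghseAcceptProb (A n) (t n) n (m n)|

end PRDM

end

noncomputable section

namespace PRDM

/-! ### Invariance of the Haar measure on pure states -/

/-! By `indistinguishable` and the triangle inequality, it is enough that for every circuit,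
efficient or not, `t` copies from the Hilbert–Schmidt ensemble and `t` maximally mixed copies differ
in acceptance probability by at most `2 * t ^ 2 / 2 ^ m`; this is negligible when `m = ω(log n)`.

For that bound, imagine the traced-out qubits of all copies being measured. The tensor power becomes
a sum over outcome tuples `z` of rank one operators `branchOp ψ z`. If the entries of `z` are
distinct, the Haar mean of the branch is exactly a scalar matrix: flipping the sign of one amplitude
kills the off-diagonal entries, and permuting basis labels equates the diagonal ones
(`integral_acceptProb_branchOp`). Hence only tuples with a collision contribute to the difference,
and by positivity each contributes at most its own probability.

A union bound over pairs of copies controls collisions by the second moments of the outcome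
distribution (`sum_prod_not_injective_le`). These come from invariance alone, through `E|ψ_a|²|ψ_b|²
= E|ψ_a|⁴ / 2` for `a ≠ b`, without integrating over the sphere explicitly. -/

/-- The action of a real-linear isometry on pure states. -/
def rotate {N : ℕ} (f : Ket N ≃ₗᵢ[ℝ] Ket N) (ψ : PureState N) : PureState N :=
  ⟨f ψ, by simp⟩

theorem continuous_rotate {N : ℕ} (f : Ket N ≃ₗᵢ[ℝ] Ket N) : Continuous (rotate f) :=
  (f.continuous.comp continuous_subtype_val).subtype_mk _

-- The surface measure of a set is a constant times the volume of the cone over it; a linear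
-- isometry commutes with forming cones and preserves volume.
open scoped Pointwise in
theorem measurePreserving_rotate_toSphere {N : ℕ} (f : Ket N ≃ₗᵢ[ℝ] Ket N) :
    MeasurePreserving (rotate f) (volume : Measure (Ket N)).toSphere
      (volume : Measure (Ket N)).toSphere := by
  refine ⟨(continuous_rotate f).measurable, ?_⟩
  ext s hs
  have hvol : MeasurePreserving f (volume : Measure (Ket N)) volume := f.measurePreserving
  rw [Measure.map_apply (continuous_rotate f).measurable hs,
    Measure.toSphere_apply' _ ((continuous_rotate f).measurable hs),
    Measure.toSphere_apply' _ hs]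
  congr 1
  have himage : Set.Ioo (0 : ℝ) 1 • ((↑) '' (rotate f ⁻¹' s) : Set (Ket N)) =
      f ⁻¹' (Set.Ioo (0 : ℝ) 1 • ((↑) '' s : Set (Ket N))) := by
    ext v
    simp only [Set.mem_smul, Set.mem_image, Set.mem_preimage]
    constructor
    · rintro ⟨r, hr, -, ⟨ψ, hψ, rfl⟩, rfl⟩
      exact ⟨r, hr, _, ⟨_, hψ, rfl⟩, (f.map_smul r _).symm⟩
    · rintro ⟨r, hr, -, ⟨ψ, hψ, rfl⟩, hv⟩
      refine ⟨r, hr, f.symm ψ, ⟨rotate f.symm ψ, ?_, rfl⟩, ?_⟩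
      · have : rotate f (rotate f.symm ψ) = ψ := Subtype.ext (f.apply_symm_apply _)
        rwa [this]
      · rw [← f.symm.map_smul, hv, f.symm_apply_apply]
  rw [himage]
  exact MeasurePreserving.measure_preimage_equiv (f := f.toMeasurableEquiv) hvol _

theorem measurePreserving_rotate {N : ℕ} (f : Ket N ≃ₗᵢ[ℝ] Ket N) :
    MeasurePreserving (rotate f) (haar N) (haar N) := by
  have h := measurePreserving_rotate_toSphere f
  exact ⟨h.measurable, by rw [haar, Measure.map_smul, h.map_eq]⟩

theorem integral_haar_rotate {N : ℕ} {G : Type*} [NormedAddCommGroup G] [NormedSpace ℝ G]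
    (f : Ket N ≃ₗᵢ[ℝ] Ket N) {F : PureState N → G} (hF : Continuous F) :
    ∫ ψ, F (rotate f ψ) ∂haar N = ∫ ψ, F ψ ∂haar N := by
  have h := measurePreserving_rotate f
  conv_rhs => rw [← h.map_eq]
  rw [integral_map h.aemeasurable]
  rw [h.map_eq]
  exact hF.aestronglyMeasurable

theorem integrable_haar {N : ℕ} {G : Type*} [NormedAddCommGroup G]
    {F : PureState N → G} (hF : Continuous F) : Integrable F (haar N) := by
  rw [← integrableOn_univ]
  exact hF.continuousOn.integrableOn_compact isCompact_univ

/-- Relabelling of the computational basis. -/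
def permIsometry {N : ℕ} (e : Equiv.Perm (Bits N)) : Ket N ≃ₗᵢ[ℝ] Ket N :=
  LinearIsometryEquiv.piLpCongrLeft 2 ℝ ℂ e

theorem permIsometry_apply {N : ℕ} (e : Equiv.Perm (Bits N)) (v : Ket N) (b : Bits N) :
    permIsometry e v b = v (e.symm b) := rfl

/-- Negation of one amplitude. -/
def flipIsometry {N : ℕ} (a : Bits N) : Ket N ≃ₗᵢ[ℝ] Ket N :=
  LinearIsometryEquiv.piLpCongrRight 2 fun b =>
    if b = a then LinearIsometryEquiv.neg ℝ else LinearIsometryEquiv.refl ℝ ℂ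

theorem flipIsometry_apply {N : ℕ} (a : Bits N) (v : Ket N) (b : Bits N) :
    flipIsometry a v b = if b = a then - v b else v b := by
  simp only [flipIsometry, LinearIsometryEquiv.piLpCongrRight_apply]
  split_ifs <;> simp

/-- Mixing of two amplitudes `p, q` into `(p + w q) / √2`, `(p - w q) / √2`. -/
def mixFun {N : ℕ} (a b : Bits N) (w : ℂ) (v : Ket N) : Ket N :=
  WithLp.toLp 2 fun x =>
    if x = a then (v a + w * v b) / (Real.sqrt 2 : ℝ)
    else if x = b then (v a - w * v b) / (Real.sqrt 2 : ℝ) else v x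

theorem normSq_add_mul_add_sub (p q w : ℂ) (hw : Complex.normSq w = 1) :
    Complex.normSq (p + w * q) + Complex.normSq (p - w * q) =
      2 * (Complex.normSq p + Complex.normSq q) := by
  rw [Complex.normSq_add, Complex.normSq_sub, Complex.normSq_mul, hw]
  ring

theorem normSq_div_sqrt_two (p : ℂ) :
    Complex.normSq (p / (Real.sqrt 2 : ℝ)) = Complex.normSq p / 2 := by
  rw [Complex.normSq_div, Complex.normSq_ofReal, Real.mul_self_sqrt (by norm_num)]

theorem norm_mixFun {N : ℕ} {a b : Bits N} (hab : a ≠ b) {w : ℂ} (hw : Complex.normSq w = 1)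
    (v : Ket N) : ‖mixFun a b w v‖ = ‖v‖ := by
  rw [EuclideanSpace.norm_eq, EuclideanSpace.norm_eq]
  congr 1
  have hb : b ∈ Finset.univ.erase a := by simp [hab.symm]
  simp only [← Complex.normSq_eq_norm_sq]
  rw [← Finset.add_sum_erase _ _ (Finset.mem_univ a),
    ← Finset.add_sum_erase _ (fun x => Complex.normSq (v x)) (Finset.mem_univ a),
    ← Finset.add_sum_erase _ _ hb, ← Finset.add_sum_erase _ (fun x => Complex.normSq (v x)) hb,
    ← add_assoc, ← add_assoc]
  congr 1
  · simp only [mixFun, if_true, if_neg hab.symm, normSq_div_sqrt_two]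
    have := normSq_add_mul_add_sub (v a) (v b) w hw
    linarith
  · refine Finset.sum_congr rfl fun x hx => ?_
    simp only [Finset.mem_erase, Finset.mem_univ, and_true] at hx
    simp [mixFun, hx.1, hx.2]

/-- `mixFun` as an isometry. -/
def mixIsometry {N : ℕ} {a b : Bits N} (hab : a ≠ b) {w : ℂ} (hw : Complex.normSq w = 1) :
    Ket N ≃ₗᵢ[ℝ] Ket N :=
  LinearIsometry.toLinearIsometryEquiv
    { toFun := mixFun a b w
      map_add' := fun u v => by
        ext x
        simp only [mixFun, PiLp.add_apply]
        split_ifs <;> ring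
      map_smul' := fun r v => by
        ext x
        simp only [mixFun, PiLp.smul_apply, Complex.real_smul, RingHom.id_apply]
        split_ifs <;> ring
      norm_map' := norm_mixFun hab hw } rfl

/-! ### Moments of Haar random states -/

/-- The probability of a measurement outcome in the computational basis. -/
def weight {N : ℕ} (ψ : PureState N) (b : Bits N) : ℝ := Complex.normSq ((ψ : Ket N) b)

theorem weight_nonneg {N : ℕ} (ψ : PureState N) (b : Bits N) : 0 ≤ weight ψ b :=
  Complex.normSq_nonneg _

@[fun_prop]
theorem continuous_amplitude {N : ℕ} (b : Bits N) :
    Continuous fun ψ : PureState N => (ψ : Ket N) b := by fun_prop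

@[fun_prop]
theorem continuous_weight {N : ℕ} (b : Bits N) : Continuous fun ψ : PureState N => weight ψ b :=
  Complex.continuous_normSq.comp (continuous_amplitude b)

theorem sum_weight {N : ℕ} (ψ : PureState N) : ∑ b, weight ψ b = 1 := by
  have h : ‖(ψ : Ket N)‖ ^ 2 = 1 := by simp
  rw [EuclideanSpace.norm_sq_eq] at h
  simpa only [weight, Complex.normSq_eq_norm_sq] using h

/-- Some permutation of the basis carries one injective family of labels to the other, and the Haar
measure is invariant under it. -/
theorem integral_weight_perm {N : ℕ} {ι : Type*} [Fintype ι] {a b : ι → Bits N}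
    (ha : Function.Injective a) (hb : Function.Injective b) :
    ∫ ψ, ∏ j, weight ψ (a j) ∂haar N = ∫ ψ, ∏ j, weight ψ (b j) ∂haar N := by
  obtain ⟨e, he⟩ := Equiv.Perm.exists_extending_pair b a hb ha
  rw [← integral_haar_rotate (permIsometry e) (F := fun ψ => ∏ j, weight ψ (a j)) (by fun_prop)]
  refine integral_congr_ae (Eventually.of_forall fun ψ => ?_)
  refine Finset.prod_congr rfl fun j _ => ?_
  simp only [weight, rotate, permIsometry_apply]
  rw [e.symm_apply_eq.2 (he j).symm]

theorem integral_weight_sq_eq {N : ℕ} (a b : Bits N) :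
    ∫ ψ, weight ψ a ^ 2 ∂haar N = ∫ ψ, weight ψ b ^ 2 ∂haar N := by
  rw [← integral_haar_rotate (permIsometry (Equiv.swap a b)) (F := fun ψ => weight ψ a ^ 2)
    (by fun_prop)]
  refine integral_congr_ae (Eventually.of_forall fun ψ => ?_)
  simp [weight, rotate, permIsometry_apply]

/-- Difference of squares: `(p + w q)(p - w q) = p² - w² q²`. -/
theorem weight_rotate_mix_mul {N : ℕ} {a b : Bits N} (hab : a ≠ b) {w : ℂ}
    (hw : Complex.normSq w = 1) (ψ : PureState N) :
    weight (rotate (mixIsometry hab hw) ψ) a * weight (rotate (mixIsometry hab hw) ψ) b =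
      Complex.normSq ((ψ : Ket N) a ^ 2 - w ^ 2 * (ψ : Ket N) b ^ 2) / 4 := by
  have ha : (rotate (mixIsometry hab hw) ψ : Ket N) a =
      ((ψ : Ket N) a + w * (ψ : Ket N) b) / (Real.sqrt 2 : ℝ) := by
    change mixFun a b w ψ a = _
    simp [mixFun]
  have hb : (rotate (mixIsometry hab hw) ψ : Ket N) b =
      ((ψ : Ket N) a - w * (ψ : Ket N) b) / (Real.sqrt 2 : ℝ) := by
    change mixFun a b w ψ b = _
    simp [mixFun, hab.symm]
  rw [weight, weight, ha, hb, normSq_div_sqrt_two, normSq_div_sqrt_two, div_mul_div_comm,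
    ← Complex.normSq_mul]
  norm_num only
  congr 2
  ring

/-- Mixing with `w = 1` and with `w = I` turns the product into `|p² - q²|² / 4` and `|p² + q²|² /
4`. The parallelogram law removes the cross terms from their sum, leaving only fourth moments. -/
theorem integral_weight_mul_weight {N : ℕ} {a b : Bits N} (hab : a ≠ b) :
    ∫ ψ, weight ψ a * weight ψ b ∂haar N = (∫ ψ, weight ψ a ^ 2 ∂haar N) / 2 := by
  have hone : Complex.normSq 1 = 1 := map_one _
  have hI : Complex.normSq Complex.I = 1 := Complex.normSq_I
  have hF : Continuous fun ψ : PureState N => weight ψ a * weight ψ b := by fun_prop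
  have hsum : (∫ ψ, weight ψ a * weight ψ b ∂haar N) + ∫ ψ, weight ψ a * weight ψ b ∂haar N =
      ∫ ψ, (weight ψ a ^ 2 + weight ψ b ^ 2) / 2 ∂haar N := by
    nth_rewrite 1 [← integral_haar_rotate (mixIsometry hab hone) hF]
    rw [← integral_haar_rotate (mixIsometry hab hI) hF, ← integral_add]
    · refine integral_congr_ae (Eventually.of_forall fun ψ => ?_)
      simp only [weight_rotate_mix_mul]
      have h := normSq_add_mul_add_sub ((ψ : Ket N) a ^ 2) ((ψ : Ket N) b ^ 2) 1 hone
      simp only [one_mul, map_pow] at h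
      simp only [one_pow, one_mul, Complex.I_sq, neg_mul, sub_neg_eq_add, weight]
      linarith
    · exact integrable_haar (hF.comp (continuous_rotate _))
    · exact integrable_haar (hF.comp (continuous_rotate _))
  rw [integral_div, integral_add (integrable_haar (by fun_prop)) (integrable_haar (by fun_prop)),
    integral_weight_sq_eq b a] at hsum
  linarith

/-- Every second moment lies between `s / 2` and `s`, and all `(2 ^ N) ^ 2` of them add up to 1 by
normalization; the lower bound therefore forces `s` to be small. -/
theorem integral_weight_mul_weight_le {N : ℕ} (a b : Bits N) :
    ∫ ψ, weight ψ a * weight ψ b ∂haar N ≤ 2 / ((2 : ℝ) ^ N) ^ 2 := by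
  set s := ∫ ψ, weight ψ a ^ 2 ∂haar N with hs
  have hs0 : 0 ≤ s := integral_nonneg fun ψ => sq_nonneg _
  have hpair : ∀ x y : Bits N, s / 2 ≤ ∫ ψ, weight ψ x * weight ψ y ∂haar N ∧
      ∫ ψ, weight ψ x * weight ψ y ∂haar N ≤ s := by
    intro x y
    by_cases hxy : x = y
    · subst hxy
      simp only [← sq]
      rw [integral_weight_sq_eq x a]
      constructor <;> linarith
    · rw [integral_weight_mul_weight hxy, integral_weight_sq_eq x a]
      constructor <;> linarith
  have hone : ∑ x : Bits N, ∑ y : Bits N, ∫ ψ, weight ψ x * weight ψ y ∂haar N = 1 := by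
    have : ∀ ψ : PureState N, ∑ x : Bits N, ∑ y : Bits N, weight ψ x * weight ψ y = 1 := by
      intro ψ
      rw [← Finset.sum_mul_sum, sum_weight, one_mul]
    have hint : ∀ x y : Bits N, Integrable (fun ψ => weight ψ x * weight ψ y) (haar N) :=
      fun x y => integrable_haar (by fun_prop)
    rw [Finset.sum_congr rfl fun x _ => (integral_finsetSum Finset.univ fun y _ => hint x y).symm,
      ← integral_finsetSum _ fun x _ => integrable_finsetSum _ fun y _ => hint x y]
    simp [this]
  have hle : ∑ x : Bits N, ∑ y : Bits N, s / 2 ≤ 1 := by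
    rw [← hone]
    exact Finset.sum_le_sum fun x _ => Finset.sum_le_sum fun y _ => (hpair x y).1
  simp only [Finset.sum_const, Finset.card_univ, Fintype.card_fun, Fintype.card_fin,
    Fintype.card_bool, nsmul_eq_mul, Nat.cast_pow, Nat.cast_ofNat] at hle
  refine (hpair a b).2.trans ?_
  rw [le_div_iff₀ (by positivity)]
  linarith

/-! ### Circuits are isometries -/

theorem conjTranspose_hadamard_mul_self {N : ℕ} (w : Fin N) :
    (Matrix.of fun x y : Bits N =>
        if ∀ i : Fin N, i ≠ w → x i = y i then
          (if x w = true ∧ y w = true then -1 else 1) / ((Real.sqrt 2 : ℝ) : ℂ)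
        else 0).conjTranspose *
      (Matrix.of fun x y : Bits N =>
        if ∀ i : Fin N, i ≠ w → x i = y i then
          (if x w = true ∧ y w = true then -1 else 1) / ((Real.sqrt 2 : ℝ) : ℂ)
        else 0) = 1 := by
  have hsqrt : ((Real.sqrt 2 : ℝ) : ℂ)⁻¹ * ((Real.sqrt 2 : ℝ) : ℂ)⁻¹ = 1 / 2 := by
    rw [← mul_inv, ← Complex.ofReal_mul, Real.mul_self_sqrt (by norm_num)]
    norm_num
  ext y y'
  -- Column `y` is supported on the two strings that agree with `y` off wire `w`, so each entry of
  -- the product has two terms.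
  rw [Matrix.mul_apply, Fintype.sum_eq_add (Function.update y w true) (Function.update y w false)]
  · have hagree : ∀ b (u : Bits N), (∀ i, i ≠ w → Function.update y w b i = u i) ↔
        ∀ i, i ≠ w → y i = u i := fun b u =>
      forall₂_congr fun i hi => by simp [hi]
    simp only [Matrix.conjTranspose_apply, Matrix.of_apply, hagree, implies_true, if_true,
      Function.update_self, true_and, Bool.false_eq_true, false_and, if_false]
    by_cases h : ∀ i, i ≠ w → y i = y' i
    · have hy : y = y' ↔ y w = y' w :=
        ⟨fun e => e ▸ rfl, fun e => funext fun i => by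
          by_cases hi : i = w
          · rw [hi, e]
          · exact h i hi⟩
      rw [if_pos h, if_pos h, Matrix.one_apply]
      simp only [hy]
      cases y w <;> cases y' w <;> simp [div_eq_mul_inv, hsqrt] <;> norm_num
    · have hy : y ≠ y' := fun e => h fun i _ => e ▸ rfl
      simp [if_neg h, Matrix.one_apply_ne hy]
  · intro e
    simpa using congrFun e w
  · rintro x ⟨h1, h2⟩
    rw [Matrix.conjTranspose_apply, Matrix.of_apply, if_neg]
    · simp
    · intro h
      have hx : x = Function.update y w (x w) := by
        ext i
        by_cases hi : i = w
        · subst hi; simp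
        · simp [hi, h i hi]
      cases hw : x w
      · exact h2 (hw ▸ hx)
      · exact h1 (hw ▸ hx)

theorem Gate.conjTranspose_op_mul_self (N : ℕ) (g : Gate) :
    (g.op N).conjTranspose * g.op N = 1 := by
  cases g with
  | hadamard w =>
    rw [Gate.op]
    split_ifs with h
    · exact conjTranspose_hadamard_mul_self ⟨w, h⟩
    · simp
  | phase j w =>
    rw [Gate.op]
    split_ifs with h
    · rw [Matrix.diagonal_conjTranspose, Matrix.diagonal_mul_diagonal, ← Matrix.diagonal_one]
      congr 1
      ext x
      simp only [Pi.star_apply]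
      split_ifs
      · rw [Complex.star_def, Complex.conj_mul']
        have : 2 * (Real.pi : ℂ) * Complex.I / 2 ^ j =
            ((2 * Real.pi / 2 ^ j : ℝ) : ℂ) * Complex.I := by
          push_cast; ring
        rw [this, Complex.norm_exp_ofReal_mul_I]
        simp
      · simp
    · simp
  | cnot c d =>
    rw [Gate.op]
    split_ifs with h
    -- The gate is the permutation matrix of `σ`, an involution because control and target differ.
    · set σ : Bits N → Bits N := fun y =>
        Function.update y ⟨d, h.2.1⟩ (xor (y ⟨d, h.2.1⟩) (y ⟨c, h.1⟩)) with hσ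
      have hcd : (⟨c, h.1⟩ : Fin N) ≠ ⟨d, h.2.1⟩ := fun e => h.2.2 (congrArg Fin.val e)
      have hinv : Function.Involutive σ := fun y => by
        simp [hσ, hcd]
      ext y y'
      rw [Matrix.mul_apply]
      simp only [Matrix.conjTranspose_apply, Matrix.of_apply]
      change ∑ x, star (if x = σ y then (1 : ℂ) else 0) * (if x = σ y' then 1 else 0) = _
      simp [Matrix.one_apply, hinv.injective.eq_iff, eq_comm]
    · simp

theorem conjTranspose_gatesOp_mul_self (N : ℕ) (gs : List Gate) :
    (gatesOp N gs).conjTranspose * gatesOp N gs = 1 := by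
  induction gs with
  | nil => simp [gatesOp]
  | cons g gs ih =>
    rw [gatesOp, Matrix.conjTranspose_mul, Matrix.mul_assoc,
      ← Matrix.mul_assoc (gatesOp N gs).conjTranspose, ih, Matrix.one_mul,
      Gate.conjTranspose_op_mul_self]

/-- The isometry `v ↦ |0…0⟩ ⊗ v`. -/
def adjoinZeros (a q : ℕ) : Matrix (Bits (a + q)) (Bits q) ℂ :=
  Matrix.of fun x y =>
    if (fun i => x (Fin.castAdd q i)) = (fun _ : Fin a => false) ∧
      (fun i => x (Fin.natAdd a i)) = y then 1 else 0

theorem adjoinZeros_conjTranspose_mul_self (a q : ℕ) :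
    (adjoinZeros a q).conjTranspose * adjoinZeros a q = 1 := by
  ext y y'
  rw [Matrix.mul_apply, ← (Fin.appendEquiv a q).sum_comp, Fintype.sum_prod_type,
    Finset.sum_comm, Fintype.sum_eq_single y]
  · rw [Fintype.sum_eq_single (fun _ => false)]
    · simp [adjoinZeros, Matrix.one_apply, Fin.appendEquiv]
    · intro u hu
      simp [adjoinZeros, Fin.appendEquiv, hu]
  · intro v hv
    simp [adjoinZeros, Fin.appendEquiv, hv]

/-- Writing the ancillas as conjugation by an isometry makes acceptance visibly linear and positive
in the input. -/
theorem tensor_zeroState {a q : ℕ} (ρ : Op q) :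
    tensor (zeroState a) ρ = adjoinZeros a q * ρ * (adjoinZeros a q).conjTranspose := by
  ext x y
  rw [Matrix.mul_apply, Fintype.sum_eq_single (fun i => y (Fin.natAdd a i)), Matrix.mul_apply,
    Fintype.sum_eq_single (fun i => x (Fin.natAdd a i))]
  · simp only [tensor, zeroState, adjoinZeros, Matrix.of_apply, Matrix.conjTranspose_apply,
      Matrix.single_apply, and_true, eq_comm (a := fun _ : Fin a => false)]
    split_ifs <;> simp_all
  · intro v hv
    simp [adjoinZeros, hv.symm]
  · intro v hv
    simp [adjoinZeros, hv.symm]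

/-- The isometry implemented by a circuit, including the adjoining of ancillas. -/
def Circuit.isometry (C : Circuit) (q : ℕ) : Matrix (Bits (C.anc + q)) (Bits q) ℂ :=
  gatesOp (C.anc + q) C.gates * adjoinZeros C.anc q

theorem Circuit.conjTranspose_isometry_mul_self (C : Circuit) (q : ℕ) :
    (C.isometry q).conjTranspose * C.isometry q = 1 := by
  rw [Circuit.isometry, Matrix.conjTranspose_mul, Matrix.mul_assoc,
    ← Matrix.mul_assoc (gatesOp _ _).conjTranspose, conjTranspose_gatesOp_mul_self,
    Matrix.one_mul, adjoinZeros_conjTranspose_mul_self]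

theorem Circuit.acceptProb_eq (C : Circuit) {q : ℕ} (ρ : Op q) :
    C.acceptProb ρ = ∑ x : Bits (C.anc + q), if ∃ h : 0 < C.anc + q, x ⟨0, h⟩ = true then
      ((C.isometry q * ρ * (C.isometry q).conjTranspose) x x).re else 0 := by
  have : runGates C.gates (tensor (zeroState C.anc) ρ) =
      C.isometry q * ρ * (C.isometry q).conjTranspose := by
    rw [runGates, tensor_zeroState, Circuit.isometry, Matrix.conjTranspose_mul]
    simp only [Matrix.mul_assoc]
  rw [Circuit.acceptProb, this]

theorem Circuit.acceptProb_nonneg (C : Circuit) {q : ℕ} {ρ : Op q} (hρ : ρ.PosSemidef) :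
    0 ≤ C.acceptProb ρ := by
  rw [Circuit.acceptProb_eq]
  refine Finset.sum_nonneg fun x _ => ?_
  split_ifs
  · exact (Complex.nonneg_iff.1 (hρ.mul_mul_conjTranspose_same _).diag_nonneg).1
  · exact le_rfl

/-- Conjugation by an isometry preserves the trace, and acceptance sums only some of the nonnegative
diagonal entries. No normalization is assumed, since branches are subnormalized. -/
theorem Circuit.acceptProb_le_trace (C : Circuit) {q : ℕ} {ρ : Op q} (hρ : ρ.PosSemidef) :
    C.acceptProb ρ ≤ ρ.trace.re := by
  have htrace : (C.isometry q * ρ * (C.isometry q).conjTranspose).trace = ρ.trace := by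
    rw [Matrix.trace_mul_comm, ← Matrix.mul_assoc, C.conjTranspose_isometry_mul_self,
      Matrix.one_mul]
  rw [Circuit.acceptProb_eq, ← htrace, Matrix.trace, Complex.re_sum]
  refine Finset.sum_le_sum fun x _ => ?_
  split_ifs
  · exact le_rfl
  · exact (Complex.nonneg_iff.1 (hρ.mul_mul_conjTranspose_same _).diag_nonneg).1

/-- The acceptance probability as a real-linear functional. -/
def Circuit.acceptLinear (C : Circuit) (q : ℕ) : Op q →ₗ[ℝ] ℝ where
  toFun := C.acceptProb
  map_add' ρ σ := by
    simp only [Circuit.acceptProb_eq, Matrix.mul_add, Matrix.add_mul, Matrix.add_apply,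
      Complex.add_re, ← Finset.sum_add_distrib]
    refine Finset.sum_congr rfl fun x _ => ?_
    split_ifs <;> simp
  map_smul' r ρ := by
    simp only [Circuit.acceptProb_eq, Matrix.mul_smul, Matrix.smul_mul, Matrix.smul_apply,
      Complex.smul_re, smul_eq_mul, Finset.mul_sum, RingHom.id_apply, mul_ite, mul_zero]

/-! ### Tensor powers of partial traces -/

/-- The vector `⊗_j v_{z_j}`, where `v_z` is the (unnormalized) state of the first `n` qubits of `ψ`
after outcome `z` on the last `m`. -/
def branch {n m t : ℕ} (ψ : PureState (n + m)) (z : Fin t → Bits m) (x : Bits (t * n)) : ℂ :=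
  ∏ j, (ψ : Ket (n + m)) (Fin.append (fun i => x (finProdFinEquiv (j, i))) (z j))

theorem continuous_branch {n m t : ℕ} (z : Fin t → Bits m) (x : Bits (t * n)) :
    Continuous fun ψ : PureState (n + m) => branch ψ z x := by
  unfold branch
  fun_prop

/-- The rank one operator of `branch`. -/
def branchOp {n m t : ℕ} (ψ : PureState (n + m)) (z : Fin t → Bits m) : Op (t * n) :=
  Matrix.vecMulVec (branch ψ z) (star (branch ψ z))

theorem branchOp_posSemidef {n m t : ℕ} (ψ : PureState (n + m)) (z : Fin t → Bits m) :
    (branchOp ψ z).PosSemidef := Matrix.posSemidef_vecMulVec_self_star _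

theorem continuous_branchOp {n m t : ℕ} (z : Fin t → Bits m) :
    Continuous fun ψ : PureState (n + m) => branchOp ψ z := by
  refine continuous_matrix fun x y => ?_
  exact (continuous_branch z x).mul (continuous_star.comp (continuous_branch z y))

/-- Each entry is a product over copies of sums over outcomes; distributing it gives a sum over
outcome tuples. -/
theorem tensorPow_traceOut_projector {n m : ℕ} (t : ℕ) (ψ : PureState (n + m)) :
    tensorPow t (traceOut (projector ψ)) = ∑ z : Fin t → Bits m, branchOp ψ z := by
  ext x y
  rw [Matrix.sum_apply]
  simp only [tensorPow, traceOut, projector, Matrix.of_apply, branchOp, Matrix.vecMulVec_apply,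
    branch, Pi.star_apply, star_prod, ← Finset.prod_mul_distrib]
  rw [Finset.prod_univ_sum, Fintype.piFinset_univ]

/-- The blocks of a string of `t * n` bits. -/
def blocks (t n : ℕ) : Bits (t * n) ≃ (Fin t → Bits n) :=
  (finProdFinEquiv.symm.arrowCongr (Equiv.refl Bool)).trans (Equiv.curry _ _ _)

theorem branch_eq {n m t : ℕ} (ψ : PureState (n + m)) (z : Fin t → Bits m) (x : Bits (t * n)) :
    branch ψ z x = ∏ j, (ψ : Ket (n + m)) (Fin.append (blocks t n x j) (z j)) := rfl

/-- The probability of outcome `z` when the last `m` qubits of `ψ` are measured. -/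
def marginal {n m : ℕ} (ψ : PureState (n + m)) (z : Bits m) : ℝ :=
  ∑ x : Bits n, weight ψ (Fin.append x z)

theorem marginal_nonneg {n m : ℕ} (ψ : PureState (n + m)) (z : Bits m) : 0 ≤ marginal ψ z :=
  Finset.sum_nonneg fun _ _ => weight_nonneg _ _

@[fun_prop]
theorem continuous_marginal {n m : ℕ} (z : Bits m) :
    Continuous fun ψ : PureState (n + m) => marginal ψ z := by
  unfold marginal
  fun_prop

theorem sum_marginal {n m : ℕ} (ψ : PureState (n + m)) : ∑ z, marginal ψ z = 1 := by
  rw [← sum_weight ψ, ← (Fin.appendEquiv n m).sum_comp, Fintype.sum_prod_type, Finset.sum_comm]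
  rfl

theorem branchOp_diag {n m t : ℕ} (ψ : PureState (n + m)) (z : Fin t → Bits m)
    (x : Bits (t * n)) :
    branchOp ψ z x x = ((∏ j, weight ψ (Fin.append (blocks t n x j) (z j)) : ℝ) : ℂ) := by
  rw [branchOp, Matrix.vecMulVec_apply, Pi.star_apply, Complex.star_def, Complex.mul_conj,
    branch_eq, map_prod]
  rfl

theorem trace_branchOp {n m t : ℕ} (ψ : PureState (n + m)) (z : Fin t → Bits m) :
    (branchOp ψ z).trace.re = ∏ j, marginal ψ (z j) := by
  simp only [marginal]
  rw [Finset.prod_univ_sum, Fintype.piFinset_univ, ← (blocks t n).sum_comp, Matrix.trace,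
    Complex.re_sum]
  refine Finset.sum_congr rfl fun x _ => ?_
  rw [Matrix.diag_apply, branchOp_diag, Complex.ofReal_re]

theorem tensorPow_maxMixed (t n : ℕ) :
    tensorPow t (maxMixed n) = (((2 : ℝ) ^ (t * n))⁻¹) • (1 : Op (t * n)) := by
  ext x y
  simp only [tensorPow, maxMixed, Matrix.of_apply, Matrix.smul_apply, smul_eq_mul,
    Finset.prod_mul_distrib, Finset.prod_const, Finset.card_univ, Fintype.card_fin,
    Complex.real_smul]
  congr 1
  · push_cast
    rw [inv_pow, ← pow_mul, mul_comm]
  · change ∏ j, (1 : Op n) (blocks t n x j) (blocks t n y j) = _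
    by_cases h : x = y
    · subst h; simp
    · rw [Matrix.one_apply_ne h]
      have h' : blocks t n x ≠ blocks t n y := (blocks t n).injective.ne h
      obtain ⟨j, hj⟩ := Function.ne_iff.1 h'
      exact Finset.prod_eq_zero (Finset.mem_univ j) (Matrix.one_apply_ne hj)

/-! ### Averaging the branches over the Haar measure -/

theorem append_eq_append_iff {n m : ℕ} {x x' : Bits n} {z z' : Bits m} :
    Fin.append x z = Fin.append x' z' ↔ x = x' ∧ z = z' := by
  rw [← Prod.mk.injEq]
  exact (Fin.appendEquiv n m).injective.eq_iff (a := (x, z)) (b := (x', z'))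

/-- Choose a copy where `x` and `y` differ. As `z` is injective, the amplitude `a` of `x` there
occurs once in the branch at `x` and never in the branch at `y`, so flipping its sign negates the
integrand. -/
theorem integral_branchOp_off_diag {n m t : ℕ} {z : Fin t → Bits m} (hz : Function.Injective z)
    {x y : Bits (t * n)} (hxy : x ≠ y) :
    ∫ ψ : PureState (n + m), branchOp ψ z x y ∂haar (n + m) = 0 := by
  obtain ⟨j₀, hj₀⟩ := Function.ne_iff.1 ((blocks t n).injective.ne hxy)
  set a : Bits (n + m) := Fin.append (blocks t n x j₀) (z j₀) with ha
  have hF : Continuous fun ψ : PureState (n + m) => branchOp ψ z x y :=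
    (continuous_branchOp z).matrix_elem x y
  have hx : ∀ ψ : PureState (n + m), branch (rotate (flipIsometry a) ψ) z x = -branch ψ z x := by
    intro ψ
    rw [branch_eq, branch_eq, ← Finset.mul_prod_erase _ _ (Finset.mem_univ j₀),
      ← Finset.mul_prod_erase Finset.univ
        (fun j => (ψ : Ket (n + m)) (Fin.append (blocks t n x j) (z j))) (Finset.mem_univ j₀),
      ← neg_mul]
    congr 1
    · simp [rotate, flipIsometry_apply, ha]
    · refine Finset.prod_congr rfl fun j hj => ?_
      have : Fin.append (blocks t n x j) (z j) ≠ a := fun e =>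
        Finset.ne_of_mem_erase hj (hz (append_eq_append_iff.1 e).2)
      simp [rotate, flipIsometry_apply, this]
  have hy : ∀ ψ : PureState (n + m), branch (rotate (flipIsometry a) ψ) z y = branch ψ z y := by
    intro ψ
    rw [branch_eq, branch_eq]
    refine Finset.prod_congr rfl fun j _ => ?_
    have : Fin.append (blocks t n y j) (z j) ≠ a := fun e => by
      obtain ⟨e₁, e₂⟩ := append_eq_append_iff.1 e
      obtain rfl := hz e₂
      exact hj₀ e₁.symm
    simp [rotate, flipIsometry_apply, this]
  have h := integral_haar_rotate (flipIsometry a) hF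
  simp only [branchOp, Matrix.vecMulVec_apply, Pi.star_apply, hx, hy, neg_mul,
    integral_neg] at h ⊢
  exact self_eq_neg.1 h.symm

/-- Distinct `z j` keep the `t` labels distinct whatever the blocks of `x` are, so the same mixed
moment appears at every diagonal position. -/
theorem integral_branchOp_diag {n m t : ℕ} {z : Fin t → Bits m} (hz : Function.Injective z)
    (x y : Bits (t * n)) :
    ∫ ψ : PureState (n + m), branchOp ψ z x x ∂haar (n + m) =
      ∫ ψ : PureState (n + m), branchOp ψ z y y ∂haar (n + m) := by
  simp only [branchOp_diag, integral_complex_ofReal]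
  rw [integral_weight_perm]
  all_goals exact fun i j e => hz (append_eq_append_iff.1 e).2

/-- The acceptance probability as a continuous linear functional. -/
def Circuit.acceptCLM (C : Circuit) (q : ℕ) : (Bits q → Bits q → ℂ) →L[ℝ] ℝ :=
  LinearMap.toContinuousLinearMap (C.acceptLinear q : (Bits q → Bits q → ℂ) →ₗ[ℝ] ℝ)

theorem Circuit.continuous_acceptProb (C : Circuit) (q : ℕ) :
    Continuous fun ρ : Op q => C.acceptProb ρ :=
  (C.acceptCLM q).continuous

theorem continuous_acceptProb_branchOp {n m t : ℕ} (C : Circuit) (z : Fin t → Bits m) :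
    Continuous fun ψ : PureState (n + m) => C.acceptProb (branchOp ψ z) :=
  (C.continuous_acceptProb _).comp (continuous_branchOp z)

theorem integral_acceptProb_branchOp {n m t : ℕ} (C : Circuit) {z : Fin t → Bits m}
    (hz : Function.Injective z) :
    ∫ ψ : PureState (n + m), C.acceptProb (branchOp ψ z) ∂haar (n + m) =
      (∫ ψ : PureState (n + m), ∏ j, marginal ψ (z j) ∂haar (n + m)) *
        C.acceptProb (tensorPow t (maxMixed n)) := by
  set x₀ : Bits (t * n) := fun _ => false
  set c : ℝ := ∫ ψ : PureState (n + m), ∏ j, weight ψ (Fin.append (blocks t n x₀ j) (z j))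
    ∂haar (n + m) with hc
  have hint : Integrable (fun (ψ : PureState (n + m)) x y => branchOp ψ z x y) (haar (n + m)) :=
    integrable_haar (continuous_branchOp z)
  have hdiag : ∀ x : Bits (t * n),
      ∫ ψ : PureState (n + m), branchOp ψ z x x ∂haar (n + m) = (c : ℂ) := by
    intro x
    rw [integral_branchOp_diag hz x x₀]
    simp only [branchOp_diag, integral_complex_ofReal, hc]
  have hmean : (∫ ψ : PureState (n + m), (fun x y => branchOp ψ z x y) ∂haar (n + m)) =
      c • (1 : Op (t * n)) := by
    funext x y
    rw [eval_integral (fun x => Integrable.eval hint x), eval_integral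
      (fun y => Integrable.eval (Integrable.eval hint x) y)]
    by_cases h : x = y
    · subst h
      rw [hdiag]
      simp
    · rw [integral_branchOp_off_diag hz h]
      simp [h]
  have hone : C.acceptProb (tensorPow t (maxMixed n)) =
      ((2 : ℝ) ^ (t * n))⁻¹ * C.acceptProb (1 : Op (t * n)) := by
    rw [tensorPow_maxMixed]
    exact (C.acceptLinear _).map_smul _ _
  -- Comparing traces identifies the scalar `c` of the mean branch.
  have hmarg : ∫ ψ : PureState (n + m), ∏ j, marginal ψ (z j) ∂haar (n + m) =
      (2 : ℝ) ^ (t * n) * c := by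
    have hsum : ∀ ψ : PureState (n + m), ∏ j, marginal ψ (z j) =
        ∑ x : Bits (t * n), ∏ j, weight ψ (Fin.append (blocks t n x j) (z j)) := by
      intro ψ
      rw [← trace_branchOp, Matrix.trace, Complex.re_sum]
      exact Finset.sum_congr rfl fun x _ => by
        rw [Matrix.diag_apply, branchOp_diag, Complex.ofReal_re]
    simp only [hsum]
    rw [integral_finsetSum _ fun x _ => integrable_haar (by fun_prop)]
    have hx : ∀ x : Bits (t * n), ∫ ψ : PureState (n + m),
        ∏ j, weight ψ (Fin.append (blocks t n x j) (z j)) ∂haar (n + m) = c := fun x =>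
      integral_weight_perm (fun i j e => hz (append_eq_append_iff.1 e).2)
        (fun i j e => hz (append_eq_append_iff.1 e).2)
    simp [hx]
  have hL := (C.acceptCLM (t * n)).integral_comp_comm hint
  rw [hmean] at hL
  have hL' : ∫ ψ : PureState (n + m), C.acceptProb (branchOp ψ z) ∂haar (n + m) =
      c * C.acceptProb (1 : Op (t * n)) :=
    hL.trans ((C.acceptLinear _).map_smul _ _)
  rw [hL', hmarg, hone]
  field_simp

/-! ### Collisions among independent samples -/

theorem sum_prod_of_eq {α ι : Type*} [Fintype α] [Fintype ι] [DecidableEq α] [DecidableEq ι]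
    {q : α → ℝ} (hq : ∑ a, q a = 1) {i j : ι} (hij : i ≠ j) :
    ∑ z : ι → α with z i = z j, ∏ l, q (z l) = ∑ a, q a ^ 2 := by
  have h : ∀ a, ∑ z : ι → α with z i = a ∧ z j = a, ∏ l, q (z l) = q a ^ 2 := by
    intro a
    -- Absorbing the indicator into the factors `i` and `j` lets the sum over `z` factor
    -- coordinatewise.
    have hprod : ∀ z : ι → α, (if z i = a ∧ z j = a then ∏ l, q (z l) else 0) =
        ∏ l, if l = i ∨ l = j then (if z l = a then q (z l) else 0) else q (z l) := by
      intro z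
      split_ifs with hz
      · refine Finset.prod_congr rfl fun l _ => ?_
        split_ifs with h1 h2
        · rfl
        · rcases h1 with rfl | rfl
          · exact absurd hz.1 h2
          · exact absurd hz.2 h2
        · rfl
      · rcases not_and_or.1 hz with hz | hz
        · exact (Finset.prod_eq_zero (Finset.mem_univ i) (by simp [hz])).symm
        · exact (Finset.prod_eq_zero (Finset.mem_univ j) (by simp [hz])).symm
    rw [Finset.sum_filter, Finset.sum_congr rfl fun z _ => hprod z, ← Fintype.piFinset_univ,
      ← Finset.prod_univ_sum (fun _ => Finset.univ) fun l b =>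
        if l = i ∨ l = j then (if b = a then q b else 0) else q b]
    have hl : ∀ l, (∑ b, if l = i ∨ l = j then (if b = a then q b else 0) else q b) =
        if l = i ∨ l = j then q a else 1 := by
      intro l
      split_ifs <;> simp [hq]
    rw [Finset.prod_congr rfl fun l _ => hl l, Finset.prod_ite, Finset.prod_const_one, mul_one,
      Finset.prod_const]
    congr 1
    rw [Finset.filter_or, Finset.filter_eq', Finset.filter_eq', if_pos (Finset.mem_univ _),
      if_pos (Finset.mem_univ _)]
    exact Finset.card_pair hij
  rw [← Finset.sum_congr rfl fun a _ => h a]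
  simp only [Finset.sum_filter]
  rw [Finset.sum_comm]
  refine Finset.sum_congr rfl fun z _ => ?_
  by_cases hz : z i = z j
  · simp [hz]
  · rw [if_neg hz, Finset.sum_eq_zero]
    rintro a -
    exact if_neg fun e => hz (e.1.trans e.2.symm)

/-- Union bound over ordered pairs of distinct positions, at most `t ^ 2` in number. -/
theorem sum_prod_not_injective_le {α : Type*} [Fintype α] [DecidableEq α] (t : ℕ) {q : α → ℝ}
    (hq0 : ∀ a, 0 ≤ q a) (hq : ∑ a, q a = 1) :
    ∑ z : Fin t → α with ¬ Function.Injective z, ∏ l, q (z l) ≤ (t : ℝ) ^ 2 * ∑ a, q a ^ 2 := by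
  have hnn : ∀ z : Fin t → α, 0 ≤ ∏ l, q (z l) := fun z => Finset.prod_nonneg fun _ _ => hq0 _
  calc ∑ z : Fin t → α with ¬ Function.Injective z, ∏ l, q (z l)
      ≤ ∑ z : Fin t → α, ∑ p ∈ (Finset.univ.offDiag : Finset (Fin t × Fin t)),
          if z p.1 = z p.2 then ∏ l, q (z l) else 0 := by
        rw [Finset.sum_filter]
        refine Finset.sum_le_sum fun z _ => ?_
        have hterm : ∀ p : Fin t × Fin t, 0 ≤ if z p.1 = z p.2 then ∏ l, q (z l) else 0 :=
          fun p => by split_ifs <;> simp [hnn z]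
        split_ifs with hz
        · exact Finset.sum_nonneg fun p _ => hterm p
        · obtain ⟨i, j, hij, hne⟩ := Function.not_injective_iff.1 hz
          refine le_trans (le_of_eq ?_) (Finset.single_le_sum (a := (i, j)) (fun p _ => hterm p)
            (Finset.mem_offDiag.2 ⟨Finset.mem_univ i, Finset.mem_univ j, hne⟩))
          rw [if_pos hij]
    _ = ∑ p ∈ (Finset.univ.offDiag : Finset (Fin t × Fin t)),
          ∑ z : Fin t → α with z p.1 = z p.2, ∏ l, q (z l) := by
        rw [Finset.sum_comm]
        exact Finset.sum_congr rfl fun p _ => (Finset.sum_filter _ _).symm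
    _ = ∑ p ∈ (Finset.univ.offDiag : Finset (Fin t × Fin t)), ∑ a, q a ^ 2 :=
        Finset.sum_congr rfl fun p hp => sum_prod_of_eq hq (Finset.mem_offDiag.1 hp).2.2
    _ ≤ (t : ℝ) ^ 2 * ∑ a, q a ^ 2 := by
        rw [Finset.sum_const, nsmul_eq_mul]
        refine mul_le_mul_of_nonneg_right ?_ (Finset.sum_nonneg fun _ _ => sq_nonneg _)
        rw [Finset.offDiag_card, Finset.card_univ, Fintype.card_fin, sq]
        exact_mod_cast Nat.sub_le _ _

/-- Expanding the squares gives `2 ^ m * (2 ^ n) ^ 2` second moments, each at most `2 / (2 ^ (n +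
m)) ^ 2`. -/
theorem integral_sum_marginal_sq_le (n m : ℕ) :
    ∫ ψ : PureState (n + m), ∑ z : Bits m, marginal ψ z ^ 2 ∂haar (n + m) ≤ 2 / 2 ^ m := by
  have hexp : ∀ ψ : PureState (n + m), ∑ z : Bits m, marginal ψ z ^ 2 =
      ∑ z : Bits m, ∑ p : Bits n × Bits n,
        weight ψ (Fin.append p.1 z) * weight ψ (Fin.append p.2 z) := by
    intro ψ
    refine Finset.sum_congr rfl fun z _ => ?_
    rw [sq, marginal, Finset.sum_mul_sum, Fintype.sum_prod_type]
  simp only [hexp]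
  have hint : ∀ (z : Bits m) (p : Bits n × Bits n), Integrable (fun ψ : PureState (n + m) =>
      weight ψ (Fin.append p.1 z) * weight ψ (Fin.append p.2 z)) (haar (n + m)) :=
    fun z p => integrable_haar (by fun_prop)
  rw [integral_finsetSum _ fun z _ => integrable_finsetSum _ fun p _ => hint z p,
    Finset.sum_congr rfl fun z _ => integral_finsetSum _ fun p _ => hint z p]
  refine (Finset.sum_le_sum fun z _ => Finset.sum_le_sum fun p _ =>
    integral_weight_mul_weight_le _ _).trans (le_of_eq ?_)
  simp only [Finset.sum_const, Finset.card_univ, Fintype.card_prod, Fintype.card_fun,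
    Fintype.card_fin, Fintype.card_bool, nsmul_eq_mul, Nat.cast_pow, Nat.cast_ofNat,
    Nat.cast_mul]
  field_simp
  ring

/-! ### The ensemble is close to the maximally mixed state -/

theorem ghseAcceptProb_eq (C : Circuit) (t n m : ℕ) :
    ghseAcceptProb C t n m =
      ∑ z : Fin t → Bits m, ∫ ψ : PureState (n + m), C.acceptProb (branchOp ψ z)
        ∂haar (n + m) := by
  have hpow : Measurable fun ρ : Op n => tensorPow t ρ := by
    refine measurable_pi_lambda _ fun x => measurable_pi_lambda _ fun y => ?_
    have hentry : ∀ u v : Bits n, Measurable fun ρ : Op n => ρ u v := fun u v =>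
      (measurable_pi_apply v).comp (measurable_pi_apply u)
    change Measurable fun ρ : Op n => ∏ j : Fin t,
      ρ (fun i => x (finProdFinEquiv (j, i))) (fun i => y (finProdFinEquiv (j, i)))
    exact Finset.measurable_prod _ fun j _ => hentry _ _
  have hacc : Measurable fun ρ : Op (t * n) => C.acceptProb ρ :=
    (C.acceptCLM (t * n)).continuous.measurable
  have hcomp : Measurable fun ρ : Op n => C.acceptProb (tensorPow t ρ) := hacc.comp hpow
  rw [ghseAcceptProb, ghse, integral_map (measurable_traceOut_projector n m).aemeasurable
    hcomp.aestronglyMeasurable, ← integral_finsetSum _ fun z _ =>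
      integrable_haar (continuous_acceptProb_branchOp C z)]
  refine integral_congr_ae (Eventually.of_forall fun ψ => ?_)
  simp only
  rw [tensorPow_traceOut_projector]
  exact map_sum (C.acceptLinear _) _ _

theorem acceptProb_maxMixed_mem (C : Circuit) (t n : ℕ) :
    C.acceptProb (tensorPow t (maxMixed n)) ∈ Set.Icc (0 : ℝ) 1 := by
  have hpsd : (tensorPow t (maxMixed n)).PosSemidef := by
    rw [tensorPow_maxMixed]
    exact Matrix.PosSemidef.one.smul (by positivity)
  refine ⟨C.acceptProb_nonneg hpsd, (C.acceptProb_le_trace hpsd).trans (le_of_eq ?_)⟩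
  rw [tensorPow_maxMixed, Matrix.trace_smul, Matrix.trace_one, Complex.smul_re,
    Complex.natCast_re]
  simp

theorem abs_ghseAcceptProb_sub_le (C : Circuit) (t n m : ℕ) :
    |ghseAcceptProb C t n m - C.acceptProb (tensorPow t (maxMixed n))| ≤
      2 * (t : ℝ) ^ 2 / 2 ^ m := by
  classical
  set s := C.acceptProb (tensorPow t (maxMixed n)) with hs
  obtain ⟨hs0, hs1⟩ := acceptProb_maxMixed_mem C t n
  set P : (Fin t → Bits m) → ℝ := fun z =>
    ∫ ψ : PureState (n + m), ∏ j, marginal ψ (z j) ∂haar (n + m) with hP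
  set Q : (Fin t → Bits m) → ℝ := fun z =>
    ∫ ψ : PureState (n + m), C.acceptProb (branchOp ψ z) ∂haar (n + m) with hQ
  have hintP : ∀ z : Fin t → Bits m, Integrable (fun ψ : PureState (n + m) =>
      ∏ j, marginal ψ (z j)) (haar (n + m)) := fun z => integrable_haar (by fun_prop)
  have hPsum : ∑ z, P z = 1 := by
    rw [hP, ← integral_finsetSum _ fun z _ => hintP z]
    have : ∀ ψ : PureState (n + m), ∑ z : Fin t → Bits m, ∏ j, marginal ψ (z j) = 1 := by
      intro ψ
      rw [← Fintype.piFinset_univ, ← Finset.prod_univ_sum (fun _ => Finset.univ)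
        fun _ b => marginal ψ b]
      simp [sum_marginal]
    simp [this]
  have hQ0 : ∀ z, 0 ≤ Q z := fun z =>
    integral_nonneg fun ψ => C.acceptProb_nonneg (branchOp_posSemidef ψ z)
  have hQP : ∀ z, Q z ≤ P z := fun z =>
    integral_mono (integrable_haar (continuous_acceptProb_branchOp C z)) (hintP z) fun ψ => by
      rw [← trace_branchOp]
      exact C.acceptProb_le_trace (branchOp_posSemidef ψ z)
  -- Without collisions the two agree exactly; otherwise both lie in `[0, P z]`, as `0 ≤ Q z ≤ P z`
  -- and `0 ≤ s ≤ 1`.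
  have hterm : ∀ z, |Q z - P z * s| ≤ if Function.Injective z then 0 else P z := by
    intro z
    split_ifs with hz
    · rw [hQ, hP, hs]
      simp only
      rw [integral_acceptProb_branchOp C hz, sub_self, abs_zero]
    · have h0 : 0 ≤ P z := (hQ0 z).trans (hQP z)
      rw [abs_le]
      constructor
      · nlinarith [hQ0 z]
      · nlinarith [hQP z]
  have hcoll : ∑ z with ¬ Function.Injective z, P z ≤ 2 * (t : ℝ) ^ 2 / 2 ^ m := by
    rw [hP, ← integral_finsetSum _ fun z _ => hintP z]
    calc ∫ ψ : PureState (n + m), ∑ z : Fin t → Bits m with ¬ Function.Injective z,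
          ∏ j, marginal ψ (z j) ∂haar (n + m)
        ≤ ∫ ψ : PureState (n + m), (t : ℝ) ^ 2 * ∑ z : Bits m, marginal ψ z ^ 2
            ∂haar (n + m) :=
          integral_mono (integrable_haar (by fun_prop)) (integrable_haar (by fun_prop)) fun ψ =>
            sum_prod_not_injective_le t (marginal_nonneg ψ) (sum_marginal ψ)
      _ ≤ (t : ℝ) ^ 2 * (2 / 2 ^ m) := by
          rw [integral_const_mul]
          exact mul_le_mul_of_nonneg_left (integral_sum_marginal_sq_le n m) (sq_nonneg _)
      _ = 2 * (t : ℝ) ^ 2 / 2 ^ m := by ring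
  calc |ghseAcceptProb C t n m - s| = |∑ z, (Q z - P z * s)| := by
        rw [ghseAcceptProb_eq, Finset.sum_sub_distrib, ← Finset.sum_mul, hPsum, one_mul]
    _ ≤ ∑ z, |Q z - P z * s| := Finset.abs_sum_le_sum_abs _ _
    _ ≤ ∑ z, if Function.Injective z then 0 else P z := Finset.sum_le_sum fun z _ => hterm z
    _ = ∑ z with ¬ Function.Injective z, P z := by
        rw [Finset.sum_filter]
        exact Finset.sum_congr rfl fun z _ => by split_ifs <;> rfl
    _ ≤ 2 * (t : ℝ) ^ 2 / 2 ^ m := hcoll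

/-! ### Negligible functions -/

theorem Negligible.add {f g : ℕ → ℝ} (hf : Negligible f) (hg : Negligible g) :
    Negligible fun n => f n + g n := by
  intro c
  -- The spare factor `n ≥ 2` absorbs the doubling.
  obtain ⟨n₁, h₁⟩ := hf (c + 1)
  obtain ⟨n₂, h₂⟩ := hg (c + 1)
  refine ⟨max 1 (max n₁ n₂), fun n hn => ?_⟩
  simp only [max_lt_iff] at hn
  have hn2 : (2 : ℝ) ≤ n := by exact_mod_cast hn.1
  have hpow : (0 : ℝ) < (n : ℝ) ^ c := by positivity
  have hhalf : 2 * ((n : ℝ) ^ (c + 1))⁻¹ ≤ ((n : ℝ) ^ c)⁻¹ := by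
    rw [pow_succ, mul_inv, ← mul_assoc, mul_comm (2 : ℝ), mul_assoc]
    refine mul_le_of_le_one_right (by positivity) ?_
    rw [← div_eq_mul_inv, div_le_one (by linarith)]
    exact hn2
  linarith [h₁ n hn.2.1, h₂ n hn.2.2]

theorem Negligible.mono {f g : ℕ → ℝ} (hg : Negligible g) (h : ∀ n, f n ≤ g n) :
    Negligible f := fun c =>
  (hg c).imp fun _ hn₀ n hn => (h n).trans_lt (hn₀ n hn)

theorem PolyBounded.exists_eventually_le_pow {t : ℕ → ℕ} (ht : PolyBounded t) :
    ∃ d : ℕ, ∀ᶠ n : ℕ in atTop, t n ≤ n ^ d := by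
  obtain ⟨p, hp⟩ := ht
  refine ⟨p.natDegree + 1, ?_⟩
  -- The coefficient sum bounds `p` on powers up to its degree; the extra power of `n` then swallows
  -- that sum.
  filter_upwards [eventually_ge_atTop (max 1 (∑ i ∈ Finset.range (p.natDegree + 1), p.coeff i))]
    with n hn
  rw [max_le_iff] at hn
  refine (hp n).trans ?_
  rw [Polynomial.eval_eq_sum_range, pow_succ']
  refine le_trans ?_ (Nat.mul_le_mul_right _ hn.2)
  rw [Finset.sum_mul]
  refine Finset.sum_le_sum fun i hi => Nat.mul_le_mul_left _ ?_
  exact Nat.pow_le_pow_right hn.1 (Nat.lt_succ_iff.1 (Finset.mem_range.1 hi))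

theorem eventually_pow_le_two_pow {m : ℕ → ℕ}
    (hm : (fun n : ℕ => Real.log (n : ℝ)) =o[atTop] (fun n : ℕ => (m n : ℝ))) (k : ℕ) :
    ∀ᶠ n : ℕ in atTop, (n : ℝ) ^ k ≤ 2 ^ m n := by
  have hlog2 : 0 < Real.log 2 := Real.log_pos (by norm_num)
  -- This constant yields `(k + 1) * log n ≤ m n * log 2`; using `k + 1` avoids dividing by zero at
  -- `k = 0`.
  have h := hm.def (c := Real.log 2 / (k + 1)) (by positivity)
  filter_upwards [h, eventually_ge_atTop 1] with n hn hn1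
  have hn0 : (0 : ℝ) < n := by exact_mod_cast hn1
  have hlog : 0 ≤ Real.log n := Real.log_nonneg (by exact_mod_cast hn1)
  rw [Real.norm_of_nonneg hlog, Real.norm_of_nonneg (Nat.cast_nonneg _), div_mul_eq_mul_div,
    le_div_iff₀ (by positivity)] at hn
  rw [← Real.log_le_log_iff (by positivity) (by positivity), Real.log_pow, Real.log_pow]
  nlinarith

theorem negligible_sq_div_two_pow {t m : ℕ → ℕ} (ht : PolyBounded t)
    (hm : (fun n : ℕ => Real.log (n : ℝ)) =o[atTop] (fun n : ℕ => (m n : ℝ))) :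
    Negligible fun n => 2 * (t n : ℝ) ^ 2 / 2 ^ m n := by
  intro c
  obtain ⟨d, hd⟩ := ht.exists_eventually_le_pow
  -- In the exponent, `2 * d` pays for `t ^ 2`, `c` for the target rate, and the last 2 for the
  -- constant, since `2 < n ^ 2` strictly.
  have h := (hd.and (eventually_pow_le_two_pow hm (2 * d + c + 2))).and (eventually_ge_atTop 2)
  obtain ⟨n₀, hn₀⟩ := eventually_atTop.1 h
  refine ⟨n₀, fun n hn => ?_⟩
  obtain ⟨⟨hle, hpow⟩, hn2⟩ := hn₀ n hn.le
  have hn2' : (2 : ℝ) ≤ n := by exact_mod_cast hn2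
  have hle' : (t n : ℝ) ≤ (n : ℝ) ^ d := by exact_mod_cast hle
  have hc : (0 : ℝ) < (n : ℝ) ^ c := by positivity
  rw [div_lt_iff₀ (by positivity), inv_mul_eq_div, lt_div_iff₀ hc]
  refine lt_of_lt_of_le ?_ hpow
  have h1 : (t n : ℝ) ^ 2 ≤ ((n : ℝ) ^ d) ^ 2 := by gcongr
  have h2 : (2 : ℝ) < (n : ℝ) ^ 2 := by nlinarith
  calc 2 * (t n : ℝ) ^ 2 * (n : ℝ) ^ c ≤ 2 * ((n : ℝ) ^ d) ^ 2 * (n : ℝ) ^ c := by gcongr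
    _ < (n : ℝ) ^ 2 * ((n : ℝ) ^ d) ^ 2 * (n : ℝ) ^ c := by gcongr
    _ = (n : ℝ) ^ (2 * d + c + 2) := by ring

end PRDM

end

theorem mainTheorem2 (κ m : ℕ → ℕ) (ρ : (n : ℕ) → PRDM.Bits (κ n) → PRDM.Op n)
    (hρ : PRDM.IsPRDM κ m ρ)
    (hm : (fun n : ℕ => Real.log (n : ℝ)) =o[atTop] (fun n : ℕ => (m n : ℝ)))
    (t : ℕ → ℕ) (ht : PRDM.PolyBounded t)
    (A : ℕ → PRDM.Circuit) (hA : PRDM.EfficientAdversary A) :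
    PRDM.Negligible fun n =>
      |PRDM.keyAcceptProb (A n) (t n) (ρ n) -
        (A n).acceptProb (PRDM.tensorPow (t n) (PRDM.maxMixed n))| :=
  ((hρ.indistinguishable t ht A hA).add (PRDM.negligible_sq_div_two_pow ht hm)).mono fun n =>
    (abs_sub_le _ (PRDM.ghseAcceptProb (A n) (t n) n (m n)) _).trans
      (add_le_add_right (PRDM.abs_ghseAcceptProb_sub_le (A n) (t n) n (m n)) _)
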